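/- A \emph{Lie ring} is a Lie algebra over $\mathbb Z$. For a Lie ring $L$ put $\gamma_1(L)=L$ and, for $n\ge 1$, let $\gamma_{n+1}(L)$ be the additive subgroup of $L$ generated by all $[x,y]$ with $x\in L$, $y\in\gamma_n(L)$. Let $\iota\colon L\to U(L)$ be the canonical map to the universal enveloping ring of $L$ over $\mathbb Z$, let $\varpi(L)$ be the two-sided ideal of $U(L)$ generated by $\iota(L)$, and put $\delta_n(L)=L\cap\varpi(L)^n=\{x\in L : \iota(x)\in\varpi(L)^n\}$ for $n\ge 1$. (1) Let $L=\bigoplus_{n\ge 0}L_n$ be a graded Lie ring (the $L_n$ are additive subgroups, $L$ is their direct sum, and $[L_m,L_n]\subseteq L_{m+n}$ for all $m,n$) that is generated as a Lie ring by $L_1$ (so that $L_0=0$). Then $\delta_4(L)=\gamma_4(L)$. (2) For a group $G$ with lower central series $\gamma_1(G)=G$, $\gamma_{n+1}(G)=[\gamma_n(G),G]$, let $\operatorname{gr}G=\bigoplus_{n\ge1}\gamma_n(G)/\gamma_{n+1}(G)$ be the Magnus Lie ring, whose bracket is the biadditive extension of $[x\gamma_{m+1}(G),\,y\gamma_{n+1}(G)]=x^{-1}y^{-1}xy\,\gamma_{m+n+1}(G)$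 for $x\in\gamma_m(G)$, $y\in\gamma_n(G)$. Then $\delta_4(\operatorname{gr}G)=\gamma_4(\operatorname{gr}G)$ for every group $G$; in particular this holds for Rips's group, the counterexample to the dimension conjecture for groups. -/

import Mathlib

open scoped DirectSum commutatorElement

/-! ### Lower central and dimension series of a Lie ring -/

/-- `γ_n(L)` for `n ≥ 1`: `γ_1(L) = L` and `γ_{n+1}(L)` is the additive subgroup generated by all
`⁅x, y⁆` with `x ∈ L`, `y ∈ γ_n(L)`. (Mathlib numbers this series from `0`.) -/
def lieGamma (L : Type*) [LieRing L] (n : ℕ) : Submodule ℤ L :=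
  (LieModule.lowerCentralSeries ℤ L L (n - 1)).toSubmodule

/-- The augmentation ideal `ϖ(L)` of the universal enveloping ring `U(L)` over `ℤ`, i.e. the
two-sided ideal generated by the image of `ι : L → U(L)`. -/
def lieAugmentation (L : Type*) [LieRing L] : Ideal (UniversalEnvelopingAlgebra ℤ L) :=
  (TwoSidedIdeal.span (Set.range (UniversalEnvelopingAlgebra.ι ℤ (L := L)))).asIdeal

/-- `δ_n(L) = L ∩ ϖ(L)^n` for `n ≥ 1`: the elements of `L` whose image in `U(L)` lies in the
`n`-th power of the augmentation ideal. -/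
def lieDelta (L : Type*) [LieRing L] (n : ℕ) : Submodule ℤ L :=
  AddSubgroup.toIntSubmodule
    { carrier := {x | UniversalEnvelopingAlgebra.ι ℤ x ∈ lieAugmentation L ^ n}
      zero_mem' := by simp
      add_mem' := fun {x y} hx hy => by
        rw [Set.mem_ofPred_eq, map_add]; exact add_mem hx hy
      neg_mem' := fun {x} hx => by
        rw [Set.mem_ofPred_eq, map_neg]; exact neg_mem hx }

theorem mem_lieDelta (L : Type*) [LieRing L] (n : ℕ) (x : L) :
    x ∈ lieDelta L n ↔ UniversalEnvelopingAlgebra.ι ℤ x ∈ lieAugmentation L ^ n := Iff.rfl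

/-! ### The Magnus Lie ring of a group -/

namespace Magnus

/-- `γ_n(G)` for `n ≥ 1`: `γ_1(G) = G`, `γ_{n+1}(G) = [γ_n(G), G]`.
(Mathlib numbers this series from `0`.) -/
def gamma (G : Type*) [Group G] (n : ℕ) : Subgroup G :=
  (⊤ : Subgroup G).lowerCentralSeries (n - 1)

section Group

variable {G : Type*} [Group G]

instance gamma_normal (n : ℕ) : (gamma G n).Normal := by
  unfold gamma; infer_instance

theorem lcs_comm_le (n : ℕ) : ∀ m : ℕ,
    ⁅(⊤ : Subgroup G).lowerCentralSeries m, (⊤ : Subgroup G).lowerCentralSeries n⁆ ≤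
      (⊤ : Subgroup G).lowerCentralSeries (m + n + 1) := by
  induction n with
  | zero => intro m; exact le_rfl
  | succ n ih =>
    intro m
    set N : Subgroup G := (⊤ : Subgroup G).lowerCentralSeries (m + (n + 1) + 1) with hN
    have key : ∀ H : Subgroup G, H.map (QuotientGroup.mk' N) = ⊥ ↔ H ≤ N := by
      intro H
      rw [Subgroup.map_eq_bot_iff, QuotientGroup.ker_mk']
    rw [Subgroup.commutator_comm, Subgroup.lowerCentralSeries_succ, ← key]
    simp only [Subgroup.map_commutator]
    apply Subgroup.commutator_commutator_eq_bot_of_rotate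
    · simp only [← Subgroup.map_commutator]
      rw [key, Subgroup.commutator_comm ⊤]
      refine (ih (m + 1)).trans (le_of_eq ?_)
      rw [hN]; congr 1; omega
    · simp only [← Subgroup.map_commutator]
      rw [key]
      exact Subgroup.commutator_mono (ih m) le_rfl

theorem gamma_antitone : Antitone (gamma G) := fun _ _ h =>
  Subgroup.lowerCentralSeries_antitone _ (Nat.sub_le_sub_right h 1)

theorem gamma_comm_le (m n : ℕ) : ⁅gamma G m, gamma G n⁆ ≤ gamma G (m + n) :=
  (lcs_comm_le (n - 1) (m - 1)).trans
    (Subgroup.lowerCentralSeries_antitone _ (by omega))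

theorem comm_mem {m n : ℕ} {x y : G} (hx : x ∈ gamma G m) (hy : y ∈ gamma G n) :
    ⁅x, y⁆ ∈ gamma G (m + n) :=
  gamma_comm_le m n (Subgroup.commutator_mem_commutator hx hy)

theorem comm_mem_of_eq {m n k : ℕ} {x y : G} (hx : x ∈ gamma G m) (hy : y ∈ gamma G n)
    (h : k ≤ m + n) : ⁅x, y⁆ ∈ gamma G k :=
  gamma_antitone h (comm_mem hx hy)

theorem mem_gamma_one (x : G) : x ∈ gamma G 1 := Subgroup.mem_top x

/-- The group commutator `x⁻¹ y⁻¹ x y`. -/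
def comm (x y : G) : G := x⁻¹ * y⁻¹ * x * y

theorem comm_eq (x y : G) : comm x y = ⁅x⁻¹, y⁻¹⁆ := by
  simp [comm, commutatorElement_def]

theorem comm_mem_gamma {m n : ℕ} {x y : G} (hx : x ∈ gamma G m) (hy : y ∈ gamma G n) :
    comm x y ∈ gamma G (m + n) := by
  rw [comm_eq]; exact comm_mem (inv_mem hx) (inv_mem hy)

end Group

/-- The homogeneous component `γ_n(G) / γ_{n+1}(G)`, written additively. -/
def Piece (G : Type*) [Group G] (n : ℕ) : Type _ :=
  Additive (gamma G n ⧸ (gamma G (n + 1)).subgroupOf (gamma G n))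

section Piece

variable {G : Type*} [Group G]

theorem mul_comm_quot (n : ℕ) (a b : gamma G n ⧸ (gamma G (n + 1)).subgroupOf (gamma G n)) :
    a * b = b * a := by
  induction a using QuotientGroup.induction_on with
  | H x =>
  induction b using QuotientGroup.induction_on with
  | H y =>
  rw [← QuotientGroup.mk_mul, ← QuotientGroup.mk_mul, QuotientGroup.eq, Subgroup.mem_subgroupOf]
  have h : ⁅(y : G)⁻¹, (x : G)⁻¹⁆ ∈ gamma G (n + 1) := by
    have h1 : ⁅(y : G)⁻¹, (x : G)⁻¹⁆ ∈ gamma G (n + 1) :=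
      match n, x, y with
      | 0, x, y => mem_gamma_one _
      | n + 1, x, y => comm_mem_of_eq (inv_mem y.2) (inv_mem x.2) (by omega)
    exact h1
  simpa [commutatorElement_def, mul_assoc] using h

instance (n : ℕ) : AddCommGroup (Piece G n) :=
  { (inferInstance :
      AddGroup (Additive (gamma G n ⧸ (gamma G (n + 1)).subgroupOf (gamma G n)))) with
    add_comm := mul_comm_quot n }

/-- The class `x γ_{n+1}(G)` of an element `x ∈ γ_n(G)`. -/
def Piece.mk {n : ℕ} (x : G) (hx : x ∈ gamma G n) : Piece G n :=
  Additive.ofMul (QuotientGroup.mk (⟨x, hx⟩ : gamma G n))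

theorem Piece.mk_mul {n : ℕ} {x y : G} (hx : x ∈ gamma G n) (hy : y ∈ gamma G n) :
    Piece.mk (x * y) (mul_mem hx hy) = Piece.mk x hx + Piece.mk y hy := rfl

theorem Piece.mk_eq {n : ℕ} {x y : G} (hx : x ∈ gamma G n) (hy : y ∈ gamma G n)
    (h : x⁻¹ * y ∈ gamma G (n + 1)) : Piece.mk x hx = Piece.mk y hy :=
  congrArg Additive.ofMul (QuotientGroup.eq.2 (Subgroup.mem_subgroupOf.2 h))

theorem Piece.mk_eq_zero {n : ℕ} {x : G} (hx : x ∈ gamma G n) (h : x ∈ gamma G (n + 1)) :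
    Piece.mk x hx = 0 :=
  (Piece.mk_eq hx (one_mem _) (by simpa using h)).trans rfl

theorem Piece.ind {n : ℕ} {p : Piece G n → Prop} (h : ∀ x hx, p (Piece.mk x hx)) (a) : p a := by
  obtain ⟨x, rfl⟩ := QuotientGroup.mk_surjective (Additive.toMul a)
  exact h x.1 x.2

/-- A homomorphism out of `γ_n(G) / γ_{n+1}(G)` from a map on `γ_n(G)`. -/
def Piece.lift {n : ℕ} {A : Type*} [AddCommGroup A] (f : gamma G n → A)
    (hmul : ∀ x y, f (x * y) = f x + f y) (h1 : ∀ x : gamma G n, (x : G) ∈ gamma G (n + 1) → f x = 0) :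
    Piece G n →+ A :=
  MonoidHom.toAdditiveLeft (QuotientGroup.lift ((gamma G (n + 1)).subgroupOf (gamma G n))
    (MonoidHom.mk' (fun x => Multiplicative.ofAdd (f x)) hmul) h1)

theorem Piece.lift_mk {n : ℕ} {A : Type*} [AddCommGroup A] (f : gamma G n → A) (hmul) (h1)
    (x : G) (hx : x ∈ gamma G n) : Piece.lift f hmul h1 (Piece.mk x hx) = f ⟨x, hx⟩ := rfl

theorem comm_mem_pnat {m n : ℕ+} {x y : G} (hx : x ∈ gamma G m) (hy : y ∈ gamma G n) :
    comm x y ∈ gamma G (m + n : ℕ+) := by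
  rw [PNat.add_coe]; exact comm_mem_gamma hx hy

theorem commutator_mem_pnat {m n : ℕ+} {x y : G} (hx : x ∈ gamma G m) (hy : y ∈ gamma G n) :
    ⁅x, y⁆ ∈ gamma G (m + n : ℕ+) := by
  rw [PNat.add_coe]; exact comm_mem hx hy

theorem mk_comm_mul_left {m n : ℕ+} {x y z : G} (hx : x ∈ gamma G m) (hy : y ∈ gamma G m)
    (hz : z ∈ gamma G n) :
    Piece.mk (comm (x * y) z) (comm_mem_pnat (mul_mem hx hy) hz) =
      Piece.mk (comm x z) (comm_mem_pnat hx hz) + Piece.mk (comm y z) (comm_mem_pnat hy hz) := by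
  refine Eq.trans ?_ (Piece.mk_mul _ _)
  apply Piece.mk_eq
  have hm := m.pos
  have h1 : ⁅y⁻¹, (comm x z)⁻¹⁆ ∈ gamma G ((m + n : ℕ+) + 1) :=
    comm_mem_of_eq (inv_mem hy) (inv_mem (comm_mem_gamma hx hz)) (by rw [PNat.add_coe]; omega)
  have h2 := (gamma_normal _).conj_mem _ h1 (comm y z)⁻¹
  convert h2 using 1
  simp only [comm, commutatorElement_def]
  group

theorem mk_comm_mul_right {m n : ℕ+} {x y z : G} (hx : x ∈ gamma G m) (hy : y ∈ gamma G n)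
    (hz : z ∈ gamma G n) :
    Piece.mk (comm x (y * z)) (comm_mem_pnat hx (mul_mem hy hz)) =
      Piece.mk (comm x y) (comm_mem_pnat hx hy) + Piece.mk (comm x z) (comm_mem_pnat hx hz) := by
  refine Eq.trans ?_ ((Piece.mk_mul (comm_mem_pnat hx hz) (comm_mem_pnat hx hy)).trans
    (add_comm _ _))
  apply Piece.mk_eq
  have hn := n.pos
  have h1 : ⁅z⁻¹, (comm x y)⁻¹⁆ ∈ gamma G ((m + n : ℕ+) + 1) :=
    comm_mem_of_eq (inv_mem hz) (inv_mem (comm_mem_gamma hx hy)) (by rw [PNat.add_coe]; omega)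
  convert h1 using 1
  simp only [comm, commutatorElement_def]
  group

/-- The pairing `γ_m/γ_{m+1} × γ_n/γ_{n+1} → γ_{m+n}/γ_{m+n+1}` (for `m, n ≥ 1`) induced by
`(x, y) ↦ x⁻¹ y⁻¹ x y`. -/
def pieceBracket (m n : ℕ+) : Piece G m →+ Piece G n →+ Piece G (m + n : ℕ+) :=
  Piece.lift
    (fun x => Piece.lift (fun y => Piece.mk (comm (x : G) y) (comm_mem_pnat x.2 y.2))
      (fun y z => mk_comm_mul_right x.2 y.2 z.2)
      (fun y hy => Piece.mk_eq_zero _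
        (gamma_antitone (by rw [PNat.add_coe]; omega) (comm_mem_gamma x.2 hy))))
    (fun x y => by
      ext a
      induction a using Piece.ind with
      | h z hz => exact mk_comm_mul_left x.2 y.2 hz)
    (fun x hx => by
      ext a
      induction a using Piece.ind with
      | h z hz =>
        exact Piece.mk_eq_zero (comm_mem_pnat x.2 hz)
          (gamma_antitone (by rw [PNat.add_coe]; omega) (comm_mem_gamma hx hz)))

end Piece

end Magnus

/-- The Magnus Lie ring `gr G = ⨁_{n ≥ 1} γ_n(G) / γ_{n+1}(G)`. -/
def MagnusLieRing (G : Type*) [Group G] : Type _ := ⨁ n : ℕ+, Magnus.Piece G n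

namespace Magnus

section Ring

variable {G : Type*} [Group G]

instance : AddCommGroup (MagnusLieRing G) :=
  inferInstanceAs (AddCommGroup (⨁ n : ℕ+, Piece G n))

/-- The inclusion of the component of degree `n` in `gr G`. -/
def incl (n : ℕ+) : Piece G n →+ MagnusLieRing G :=
  DirectSum.of (fun n : ℕ+ => Piece G n) n

/-- The pairings `pieceBracket m n` for fixed `m`, extended additively in the second argument. -/
def bracketHomAux (m : ℕ+) : MagnusLieRing G →+ Piece G m →+ MagnusLieRing G :=
  DirectSum.toAddMonoid fun n : ℕ+ =>
    AddMonoidHom.flip <| (AddMonoidHom.compHom (incl (m + n))).comp (pieceBracket m n)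

/-- The biadditive extension to `gr G` of the pairings `pieceBracket`. -/
def bracketHom : MagnusLieRing G →+ MagnusLieRing G →+ MagnusLieRing G :=
  DirectSum.toAddMonoid fun m : ℕ+ => (bracketHomAux m).flip

instance : Bracket (MagnusLieRing G) (MagnusLieRing G) := ⟨fun a b => bracketHom a b⟩

/-- The homogeneous element of degree `n` of `gr G` given by `x ∈ γ_n(G)`. -/
def cls (n : ℕ+) (x : G) (hx : x ∈ gamma G n) : MagnusLieRing G := incl n (Piece.mk x hx)

/-- `[x γ_{m+1}(G), y γ_{n+1}(G)] = x⁻¹ y⁻¹ x y γ_{m+n+1}(G)`. -/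
theorem cls_bracket (m n : ℕ+) {x y : G} (hx : x ∈ gamma G m) (hy : y ∈ gamma G n) :
    ⁅cls m x hx, cls n y hy⁆ = cls (m + n) (x⁻¹ * y⁻¹ * x * y) (comm_mem_pnat hx hy) := by
  change bracketHom (incl m (Piece.mk x hx)) (incl n (Piece.mk y hy)) = _
  have h1 : bracketHom (incl m (Piece.mk x hx)) = (bracketHomAux m).flip (Piece.mk x hx) :=
    DirectSum.toAddMonoid_of (fun m : ℕ+ => (bracketHomAux (G := G) m).flip) m (Piece.mk x hx)
  have h2 : bracketHomAux m (incl n (Piece.mk y hy)) =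
      ((AddMonoidHom.compHom (incl (m + n))).comp (pieceBracket m n)).flip (Piece.mk y hy) :=
    DirectSum.toAddMonoid_of (fun n : ℕ+ =>
      ((AddMonoidHom.compHom (incl (G := G) (m + n))).comp (pieceBracket m n)).flip) n
      (Piece.mk y hy)
  rw [h1, AddMonoidHom.flip_apply, h2]
  rfl

theorem cls_ind {p : MagnusLieRing G → Prop} (h0 : p 0) (hadd : ∀ a b, p a → p b → p (a + b))
    (h : ∀ n x hx, p (cls n x hx)) (a : MagnusLieRing G) : p a := by
  refine DirectSum.induction_on (motive := p) a h0 (fun n b => ?_) hadd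
  induction b using Piece.ind with
  | h x hx => exact h n x hx

theorem cls_mul (n : ℕ+) {x y : G} (hx : x ∈ gamma G n) (hy : y ∈ gamma G n) :
    cls n (x * y) (mul_mem hx hy) = cls n x hx + cls n y hy := by
  exact (congrArg (incl n) (Piece.mk_mul hx hy)).trans (map_add _ _ _)

theorem cls_one (n : ℕ+) : cls n (1 : G) (one_mem _) = 0 := map_zero (incl n)

theorem cls_inv (n : ℕ+) {x : G} (hx : x ∈ gamma G n) :
    cls n x⁻¹ (inv_mem hx) = -cls n x hx := by
  rw [eq_neg_iff_add_eq_zero, ← cls_mul, ← cls_one n]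
  congr 1
  simp

theorem cls_eq {m n : ℕ+} {x : G} (hx : x ∈ gamma G m) (h : m = n) :
    cls m x hx = cls n x (h ▸ hx) := by
  subst h; rfl

theorem cls_conj (n : ℕ+) {x : G} (g : G) (hx : x ∈ gamma G n) :
    cls n (g * x * g⁻¹) ((gamma_normal _).conj_mem x hx g) = cls n x hx := by
  unfold cls
  congr 1
  apply Piece.mk_eq
  have h : ⁅g, x⁻¹⁆ ∈ gamma G (n + 1) :=
    comm_mem_of_eq (mem_gamma_one g) (inv_mem hx) (by omega)
  simpa [commutatorElement_def, mul_assoc] using h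

theorem bracket_add_left (a b c : MagnusLieRing G) : ⁅a + b, c⁆ = ⁅a, c⁆ + ⁅b, c⁆ := by
  change bracketHom (a + b) c = bracketHom a c + bracketHom b c
  simp

theorem bracket_add_right (a b c : MagnusLieRing G) : ⁅a, b + c⁆ = ⁅a, b⁆ + ⁅a, c⁆ := by
  change bracketHom a (b + c) = bracketHom a b + bracketHom a c
  simp

theorem bracket_zero_left (a : MagnusLieRing G) : ⁅(0 : MagnusLieRing G), a⁆ = 0 := by
  change bracketHom 0 a = 0
  simp

theorem bracket_zero_right (a : MagnusLieRing G) : ⁅a, (0 : MagnusLieRing G)⁆ = 0 :=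
  map_zero (bracketHom a)

theorem bracket_neg_left (a b : MagnusLieRing G) : ⁅-a, b⁆ = -⁅a, b⁆ := by
  change bracketHom (-a) b = -bracketHom a b
  simp

theorem bracket_neg_right (a b : MagnusLieRing G) : ⁅a, -b⁆ = -⁅a, b⁆ :=
  map_neg (bracketHom a) b

theorem cls_bracket_alt (m n : ℕ+) {x y : G} (hx : x ∈ gamma G m) (hy : y ∈ gamma G n) :
    ⁅cls m x hx, cls n y hy⁆ = cls (m + n) ⁅x, y⁆ (commutator_mem_pnat hx hy) := by
  have h := cls_bracket m n (inv_mem hx) (inv_mem hy)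
  rw [cls_inv m hx, cls_inv n hy, bracket_neg_left, bracket_neg_right, neg_neg] at h
  rw [h]
  simp [commutatorElement_def]

theorem bracket_skew (a b : MagnusLieRing G) : ⁅a, b⁆ = -⁅b, a⁆ := by
  induction a using cls_ind with
  | h0 => rw [bracket_zero_left, bracket_zero_right, neg_zero]
  | hadd a a' h h' => rw [bracket_add_left, bracket_add_right, h, h', neg_add]
  | h m x hx =>
  induction b using cls_ind with
  | h0 => rw [bracket_zero_left, bracket_zero_right, neg_zero]
  | hadd a a' h h' => rw [bracket_add_left, bracket_add_right, h, h', neg_add]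
  | h n y hy =>
  rw [cls_bracket_alt m n hx hy, cls_bracket_alt n m hy hx,
    ← cls_inv (n + m) (commutator_mem_pnat hy hx), cls_eq _ (add_comm m n)]
  congr 1
  exact (commutatorElement_inv y x).symm

theorem bracket_self (a : MagnusLieRing G) : ⁅a, a⁆ = 0 := by
  induction a using cls_ind with
  | h0 => rw [bracket_zero_left]
  | hadd a b h h' =>
    rw [bracket_add_left, bracket_add_right, bracket_add_right, h, h', bracket_skew a b]
    simp
  | h m x hx =>
    rw [cls_bracket_alt, ← cls_one (m + m)]
    congr 1
    exact commutatorElement_self x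

theorem bracket_jacobi (a b c : MagnusLieRing G) :
    ⁅⁅a, b⁆, c⁆ + ⁅⁅b, c⁆, a⁆ + ⁅⁅c, a⁆, b⁆ = 0 := by
  induction a using cls_ind with
  | h0 => simp only [bracket_zero_left, bracket_zero_right, add_zero]
  | hadd a a' h h' =>
    simp only [bracket_add_left, bracket_add_right]
    rw [← add_zero (0 : MagnusLieRing G)]
    nth_rewrite 1 [← h]
    rw [← h']
    abel
  | h m x hx =>
  induction b using cls_ind with
  | h0 => simp only [bracket_zero_left, bracket_zero_right, add_zero]
  | hadd a a' h h' =>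
    simp only [bracket_add_left, bracket_add_right]
    rw [← add_zero (0 : MagnusLieRing G)]
    nth_rewrite 1 [← h]
    rw [← h']
    abel
  | h n y hy =>
  induction c using cls_ind with
  | h0 => simp only [bracket_zero_left, bracket_zero_right, add_zero]
  | hadd a a' h h' =>
    simp only [bracket_add_left, bracket_add_right]
    rw [← add_zero (0 : MagnusLieRing G)]
    nth_rewrite 1 [← h]
    rw [← h']
    abel
  | h k z hz =>
  have e1 : ⁅⁅cls m x hx, cls n y hy⁆, cls k z hz⁆ = cls (m + n + k) ⁅⁅x, y⁆, y * z * y⁻¹⁆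
      (commutator_mem_pnat (commutator_mem_pnat hx hy) ((gamma_normal _).conj_mem z hz y)) := by
    rw [← cls_bracket_alt _ _ (commutator_mem_pnat hx hy) ((gamma_normal _).conj_mem z hz y),
      ← cls_bracket_alt m n hx hy, cls_conj k y hz]
  have e2 : ⁅⁅cls n y hy, cls k z hz⁆, cls m x hx⁆ = cls (n + k + m) ⁅⁅y, z⁆, z * x * z⁻¹⁆
      (commutator_mem_pnat (commutator_mem_pnat hy hz) ((gamma_normal _).conj_mem x hx z)) := by
    rw [← cls_bracket_alt _ _ (commutator_mem_pnat hy hz) ((gamma_normal _).conj_mem x hx z),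
      ← cls_bracket_alt n k hy hz, cls_conj m z hx]
  have e3 : ⁅⁅cls k z hz, cls m x hx⁆, cls n y hy⁆ = cls (k + m + n) ⁅⁅z, x⁆, x * y * x⁻¹⁆
      (commutator_mem_pnat (commutator_mem_pnat hz hx) ((gamma_normal _).conj_mem y hy x)) := by
    rw [← cls_bracket_alt _ _ (commutator_mem_pnat hz hx) ((gamma_normal _).conj_mem y hy x),
      ← cls_bracket_alt k m hz hx, cls_conj n x hy]
  rw [e1, e2, e3,
    cls_eq (m := n + k + m) (n := m + n + k) _ (by rw [add_comm, add_assoc]),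
    cls_eq (m := k + m + n) (n := m + n + k) _ (by rw [add_assoc, add_comm]),
    ← cls_mul, ← cls_mul, ← cls_one (m + n + k)]
  congr 1
  exact commutatorElement_commutatorElement_conj_mul x y z

instance : LieRing (MagnusLieRing G) where
  add_lie := bracket_add_left
  lie_add := bracket_add_right
  lie_self := bracket_self
  leibniz_lie a b c := by
    have h := bracket_jacobi a b c
    rw [bracket_skew a ⁅b, c⁆, bracket_skew b ⁅a, c⁆, bracket_skew a c, bracket_neg_left, neg_neg]
    rw [← sub_eq_zero, ← neg_eq_zero, ← h]
    abel

end Ring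

end Magnus

/-! ### Additive splittings of the bracket and of the double bracket -/

/-! The hard inclusion is `δ_4 ⊆ γ_4`. It follows from a representation of `L` that sees the
components `p₁ x`, `p₂ x`, `p₃ x` and raises a filtration `F 0 ⊇ F 1 ⊇ ...` with `F 4 = 0` by one
step. The `n`-th power of the augmentation ideal raises the filtration by `n`, so `x ∈ δ_4` acts as
zero; reading off its action on the degree-zero generator gives `p₁ x = p₂ x = p₃ x = 0`. Generation
in degree one puts the remainder `x - (p₁ x + p₂ x + p₃ x)` in `γ_4`.

The representation needs an additive embedding `χ : L → Q` after which the bracket is the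
antisymmetrization of a biadditive `s`, and the double bracket `⁅a, ⁅b, c⁆⁆` that of a triadditive
`t` in `b, c`, with `t` symmetric in `a, b`. On a finitely generated subgroup these exist without
division: split it into cyclic summands, order the summands, and assign bracket values according to
the order of the indices. Multiples of one generator commute, so the diagonal terms cause no
obstruction, and the Jacobi identity makes the rule for `t` consistent. These choices need not be
compatible as the subgroup grows, so `Q` consists of germs of `L`-valued functions along the
directed set of finite subsets of `L`, where identities need only hold eventually.

The main steps are `exists_splitting_maps`, `actionFun_lie`, `eq_zero_of_mem_lieDelta` and
`sub_mem_lowerCentralSeries`. The Magnus Lie ring is covered because it too is generated in degree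
one. -/

theorem AddCommGroup.exists_sum_zmultiples (B : Type*) [AddCommGroup B] [Module.Finite ℤ B] :
    ∃ (n : ℕ) (π : Fin n → B →+ B), (∀ b, ∑ i, π i b = b) ∧
      ∀ i, ∃ g : B, ∀ b, π i b ∈ AddSubgroup.zmultiples g := by
  classical
  obtain ⟨m, κ, _, p, -, e, ⟨E⟩⟩ := Module.equiv_free_prod_directSum (R := ℤ) (M := B)
  suffices h : ∃ π : Fin m ⊕ κ → B →+ B, (∀ b, ∑ i, π i b = b) ∧
      ∀ i, ∃ g : B, ∀ b, π i b ∈ AddSubgroup.zmultiples g by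
    obtain ⟨π, h1, h2⟩ := h
    let f := Fintype.equivFin (Fin m ⊕ κ)
    refine ⟨_, fun i => π (f.symm i), fun b => ?_, fun i => h2 _⟩
    exact (Equiv.sum_comp f.symm (fun i => π i b)).trans (h1 b)
  let Z : κ → Type := fun i => ℤ ⧸ Submodule.span ℤ {p i ^ e i}
  -- Each coordinate projection is followed by the inclusion of its cyclic summand; conjugation by
  -- `E` moves these endomorphisms to `B`.
  let P : Fin m ⊕ κ → ((Fin m →₀ ℤ) × ⨁ i, Z i) →+ ((Fin m →₀ ℤ) × ⨁ i, Z i) :=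
    Sum.elim
      (fun i => (AddMonoidHom.inl _ _).comp ((Finsupp.singleAddHom i).comp
        ((Finsupp.applyAddHom i).comp (AddMonoidHom.fst _ _))))
      (fun i => (AddMonoidHom.inr _ _).comp ((DFinsupp.singleAddHom Z i).comp
        ((DFinsupp.evalAddMonoidHom i).comp (AddMonoidHom.snd _ _))))
  have hP : ∀ x, ∑ i, P i x = x := by
    intro x
    rw [Fintype.sum_sum_type]
    have h1 : ∑ i, P (Sum.inl i) x = (x.1, 0) := by
      have : ∀ i, P (Sum.inl i) x = AddMonoidHom.inl _ _ (Finsupp.single i (x.1 i)) := fun i => rfl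
      simp_rw [this, ← map_sum, Finsupp.univ_sum_single]
      rfl
    have h2 : ∑ i, P (Sum.inr i) x = (0, x.2) := by
      have : ∀ i, P (Sum.inr i) x = AddMonoidHom.inr _ _ (DirectSum.of Z i (x.2 i)) := fun i => rfl
      simp_rw [this, ← map_sum, DirectSum.sum_univ_of]
      rfl
    rw [h1, h2]
    simp
  have hc : ∀ i, ∃ g, ∀ x, ∃ k : ℤ, P i x = k • g := by
    rintro (i | i)
    · refine ⟨(Finsupp.single i 1, 0), fun x => ⟨x.1 i, ?_⟩⟩
      change ((Finsupp.single i (x.1 i), 0) : (Fin m →₀ ℤ) × ⨁ i, Z i) = _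
      ext1 <;> simp
    · refine ⟨(0, DirectSum.of Z i (Submodule.Quotient.mk 1)), fun x => ?_⟩
      obtain ⟨k, hk⟩ := Submodule.Quotient.mk_surjective _ (x.2 i)
      refine ⟨k, ?_⟩
      change ((0, DirectSum.of Z i (x.2 i)) : (Fin m →₀ ℤ) × ⨁ i, Z i) = _
      rw [← hk, Prod.smul_mk, smul_zero, ← map_zsmul, ← Submodule.Quotient.mk_smul, smul_eq_mul,
        mul_one]
  refine ⟨fun i => (E.symm : _ →+ B).comp ((P i).comp (E : B →+ _)), fun b => ?_, fun i => ?_⟩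
  · change ∑ i, E.symm (P i (E b)) = b
    rw [← map_sum, hP, E.symm_apply_apply]
  · obtain ⟨g, hg⟩ := hc i
    refine ⟨E.symm g, fun b => ?_⟩
    obtain ⟨k, hk⟩ := hg (E b)
    refine ⟨k, ?_⟩
    change k • E.symm g = E.symm (P i (E b))
    rw [hk, map_zsmul]

/-! ### Ordered bracket sums over cyclic summands -/

section Splitting

variable {L : Type*} [LieRing L]

/-- A family of maps that on `B` is a decomposition of the identity into finitely many additive
maps, each of which has pairwise commuting values. -/
structure IsAbelianSplitting (B : AddSubgroup L) {n : ℕ} (π : Fin n → L → L) : Prop where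
  map_add : ∀ i, ∀ a ∈ B, ∀ b ∈ B, π i (a + b) = π i a + π i b
  sum_eq : ∀ a ∈ B, ∑ i, π i a = a
  lie_eq : ∀ i a b, ⁅π i a, π i b⁆ = 0

/-- A cyclic summand consists of integer multiples of one element, and such multiples commute
because `⁅g, g⁆ = 0`. -/
theorem exists_isAbelianSplitting (S : Finset L) :
    ∃ (n : ℕ) (π : Fin n → L → L), IsAbelianSplitting (AddSubgroup.closure (S : Set L)) π := by
  classical
  set B := AddSubgroup.closure (S : Set L)
  have : AddGroup.FG B := (AddGroup.fg_iff_addSubgroup_fg B).2 ⟨S, rfl⟩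
  have : Module.Finite ℤ B := Module.Finite.iff_addGroup_fg.2 this
  obtain ⟨n, π, h1, h2⟩ := AddCommGroup.exists_sum_zmultiples B
  -- The value `0` off `B` makes `lie_eq` hold without membership assumptions.
  refine ⟨n, fun i a => if h : a ∈ B then (π i ⟨a, h⟩ : L) else 0, ?_, ?_, ?_⟩
  · intro i a ha b hb
    simp only [ha, hb, add_mem ha hb, dite_true]
    rw [← AddSubgroup.coe_add, ← map_add]
    rfl
  · intro a ha
    simp only [ha, dite_true]
    rw [← AddSubgroup.val_finsetSum, h1]
  · intro i a b
    obtain ⟨g, hg⟩ := h2 i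
    by_cases ha : a ∈ B <;> by_cases hb : b ∈ B <;> simp only [ha, hb, dite_true, dite_false,
      lie_zero, zero_lie]
    obtain ⟨k, hk⟩ := hg ⟨a, ha⟩
    obtain ⟨l, hl⟩ := hg ⟨b, hb⟩
    dsimp only at hk hl
    rw [← hk, ← hl]
    simp

/-- The value on basis elements of an additive `s` with `s a b - s b a = ⁅a, b⁆`. -/
def orderedLie {n : ℕ} (i j : Fin n) (u v : L) : L := if j < i then ⁅u, v⁆ else 0

/-- The value on basis elements of an additive `t`, symmetric in its first two arguments, with
`t a b c - t a c b = ⁅a, ⁅b, c⁆⁆`. -/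
def orderedLieLie {n : ℕ} (i j k : Fin n) (u v w : L) : L :=
  if k < max i j then if i ≤ j then ⁅u, ⁅v, w⁆⁆ else ⁅v, ⁅u, w⁆⁆ else 0

theorem lie_lie_comm_of_lie_eq_zero {u v : L} (h : ⁅u, v⁆ = 0) (w : L) :
    ⁅u, ⁅v, w⁆⁆ = ⁅v, ⁅u, w⁆⁆ := by
  rw [leibniz_lie, h, zero_lie, zero_add]

/-- For distinct indices exactly one of the two terms is nontrivial; for equal indices both sides
vanish. -/
theorem orderedLie_sub {n : ℕ} {i j : Fin n} {u v : L} (h : i = j → ⁅u, v⁆ = 0) :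
    orderedLie i j u v - orderedLie j i v u = ⁅u, v⁆ := by
  unfold orderedLie
  rcases lt_trichotomy i j with hij | hij | hij
  · rw [if_neg hij.not_gt, if_pos hij, zero_sub, lie_skew]
  · simp [h hij, hij]
  · rw [if_pos hij, if_neg hij.not_gt, sub_zero]

/-- Exchanging `i` and `j` exchanges the two branches of the definition. At a tie, the branches
agree because `u` and `v` commute. -/
theorem orderedLieLie_comm {n : ℕ} {i j : Fin n} (k : Fin n) {u v : L} (w : L)
    (h : i = j → ⁅u, v⁆ = 0) : orderedLieLie i j k u v w = orderedLieLie j i k v u w := by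
  unfold orderedLieLie
  rcases lt_trichotomy i j with hij | hij | hij
  · simp [hij.le, hij.not_ge]
  · simp [hij, lie_lie_comm_of_lie_eq_zero (h hij)]
  · simp [hij.le, hij.not_ge]

/-- If `i ≤ k`, only the second term survives. If `k < i`, both survive and their difference is the
Jacobi identity. -/
theorem orderedLieLie_sub_of_lt {n : ℕ} {i j k : Fin n} {u v w : L} (hjk : j < k) :
    orderedLieLie i j k u v w - orderedLieLie i k j u w v = ⁅u, ⁅v, w⁆⁆ := by
  unfold orderedLieLie
  simp only [lt_max_iff]
  rcases le_or_gt i k with hik | hik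
  · rw [if_neg (by rintro (h | h) <;> order), if_pos (Or.inr hjk), if_pos hik, ← lie_skew v w,
      lie_neg, zero_sub]
  · rw [if_pos (Or.inl hik), if_neg (by order), if_pos (Or.inr hjk), if_neg (by order),
      leibniz_lie u v w, ← lie_skew w ⁅u, v⁆]
    abel

theorem orderedLieLie_sub {n : ℕ} {i j k : Fin n} {u v w : L} (hjk : j = k → ⁅v, w⁆ = 0) :
    orderedLieLie i j k u v w - orderedLieLie i k j u w v = ⁅u, ⁅v, w⁆⁆ := by
  rcases lt_trichotomy j k with h | rfl | h
  · exact orderedLieLie_sub_of_lt h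
  · have hvw := hjk rfl
    unfold orderedLieLie
    have hwv : ⁅w, v⁆ = 0 := by rw [← lie_skew, hvw, neg_zero]
    -- On the diagonal the two terms must coincide; this is the Jacobi identity when `⁅v, w⁆ = 0`.
    have e : ⁅v, ⁅u, w⁆⁆ = ⁅w, ⁅u, v⁆⁆ := by
      rw [leibniz_lie v u w, hvw, lie_zero, add_zero, ← lie_skew w ⁅u, v⁆, ← lie_skew v u, neg_lie]
    rw [hvw, hwv, e, lie_zero, sub_self]
  · rw [← neg_sub, orderedLieLie_sub_of_lt h, ← lie_neg, lie_skew]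

theorem orderedLie_add_left {n : ℕ} (i j : Fin n) (u u' v : L) :
    orderedLie i j (u + u') v = orderedLie i j u v + orderedLie i j u' v := by
  unfold orderedLie; split_ifs <;> simp

theorem orderedLie_add_right {n : ℕ} (i j : Fin n) (u v v' : L) :
    orderedLie i j u (v + v') = orderedLie i j u v + orderedLie i j u v' := by
  unfold orderedLie; split_ifs <;> simp

theorem orderedLieLie_add_left {n : ℕ} (i j k : Fin n) (u u' v w : L) :
    orderedLieLie i j k (u + u') v w = orderedLieLie i j k u v w + orderedLieLie i j k u' v w := by
  unfold orderedLieLie; split_ifs <;> simp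

theorem orderedLieLie_add_mid {n : ℕ} (i j k : Fin n) (u v v' w : L) :
    orderedLieLie i j k u (v + v') w = orderedLieLie i j k u v w + orderedLieLie i j k u v' w := by
  unfold orderedLieLie; split_ifs <;> simp

theorem orderedLieLie_add_right {n : ℕ} (i j k : Fin n) (u v w w' : L) :
    orderedLieLie i j k u v (w + w') = orderedLieLie i j k u v w + orderedLieLie i j k u v w' := by
  unfold orderedLieLie; split_ifs <;> simp

/-- The sum of `orderedLie` over the components of the arguments. -/
def splitLie {n : ℕ} (π : Fin n → L → L) (a b : L) : L :=
  ∑ i, ∑ j, orderedLie i j (π i a) (π j b)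

/-- The sum of `orderedLieLie` over the components of the arguments. -/
def splitLieLie {n : ℕ} (π : Fin n → L → L) (a b c : L) : L :=
  ∑ i, ∑ j, ∑ k, orderedLieLie i j k (π i a) (π j b) (π k c)

namespace IsAbelianSplitting

variable {B : AddSubgroup L} {n : ℕ} {π : Fin n → L → L}

theorem lie_eq_of_eq (h : IsAbelianSplitting B π) {i j : Fin n} (a b : L) (hij : i = j) :
    ⁅π i a, π j b⁆ = 0 := by
  subst hij; exact h.lie_eq i a b

theorem splitLie_add_left (h : IsAbelianSplitting B π) {a a' : L} (ha : a ∈ B) (ha' : a' ∈ B)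
    (b : L) : splitLie π (a + a') b = splitLie π a b + splitLie π a' b := by
  simp only [splitLie, h.map_add _ a ha a' ha', orderedLie_add_left, Finset.sum_add_distrib]

theorem splitLie_add_right (h : IsAbelianSplitting B π) (a : L) {b b' : L} (hb : b ∈ B)
    (hb' : b' ∈ B) : splitLie π a (b + b') = splitLie π a b + splitLie π a b' := by
  simp only [splitLie, h.map_add _ b hb b' hb', orderedLie_add_right, Finset.sum_add_distrib]

theorem splitLieLie_add_left (h : IsAbelianSplitting B π) {a a' : L} (ha : a ∈ B) (ha' : a' ∈ B)
    (b c : L) : splitLieLie π (a + a') b c = splitLieLie π a b c + splitLieLie π a' b c := by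
  simp only [splitLieLie, h.map_add _ a ha a' ha', orderedLieLie_add_left, Finset.sum_add_distrib]

theorem splitLieLie_add_mid (h : IsAbelianSplitting B π) (a : L) {b b' : L} (hb : b ∈ B)
    (hb' : b' ∈ B) (c : L) :
    splitLieLie π a (b + b') c = splitLieLie π a b c + splitLieLie π a b' c := by
  simp only [splitLieLie, h.map_add _ b hb b' hb', orderedLieLie_add_mid, Finset.sum_add_distrib]

theorem splitLieLie_add_right (h : IsAbelianSplitting B π) (a b : L) {c c' : L} (hc : c ∈ B)
    (hc' : c' ∈ B) : splitLieLie π a b (c + c') = splitLieLie π a b c + splitLieLie π a b c' := by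
  simp only [splitLieLie, h.map_add _ c hc c' hc', orderedLieLie_add_right, Finset.sum_add_distrib]

theorem splitLie_sub (h : IsAbelianSplitting B π) {a b : L} (ha : a ∈ B) (hb : b ∈ B) :
    splitLie π a b - splitLie π b a = ⁅a, b⁆ := by
  have e : splitLie π b a = ∑ i, ∑ j, orderedLie j i (π j b) (π i a) := Finset.sum_comm
  rw [e, splitLie]
  simp only [← Finset.sum_sub_distrib, orderedLie_sub (h.lie_eq_of_eq a b)]
  simp only [← lie_sum, ← sum_lie, h.sum_eq a ha, h.sum_eq b hb]

theorem splitLieLie_comm (h : IsAbelianSplitting B π) (a b c : L) :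
    splitLieLie π a b c = splitLieLie π b a c := by
  rw [splitLieLie, Finset.sum_comm]
  simp only [splitLieLie, orderedLieLie_comm _ _ (h.lie_eq_of_eq a b)]

theorem splitLieLie_sub (h : IsAbelianSplitting B π) {a b c : L} (ha : a ∈ B) (hb : b ∈ B)
    (hc : c ∈ B) : splitLieLie π a b c - splitLieLie π a c b = ⁅a, ⁅b, c⁆⁆ := by
  have e : splitLieLie π a c b =
      ∑ i, ∑ j, ∑ k, orderedLieLie i k j (π i a) (π k c) (π j b) :=
    Finset.sum_congr rfl fun _ _ => Finset.sum_comm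
  rw [e, splitLieLie]
  simp only [← Finset.sum_sub_distrib, orderedLieLie_sub (h.lie_eq_of_eq b c)]
  simp only [← lie_sum, ← sum_lie, h.sum_eq a ha, h.sum_eq b hb, h.sum_eq c hc]

end IsAbelianSplitting

universe u

open Filter in
/-- There are an abelian group `Q` containing `L`, a biadditive `s : L × L → Q` whose
antisymmetrization is the bracket, and a triadditive `t : L × L × L → Q`, symmetric in the first two
arguments, whose antisymmetrization in the last two arguments is the double bracket. -/
theorem exists_splitting_maps (L : Type u) [LieRing L] :
    ∃ (Q : Type u) (_ : AddCommGroup Q) (χ : L →+ Q) (s : L →+ L →+ Q) (t : L →+ L →+ L →+ Q),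
      Function.Injective χ ∧ (∀ a b, s a b - s b a = χ ⁅a, b⁆) ∧
      (∀ a b c, t a b c = t b a c) ∧ ∀ a b c, t a b c - t a c b = χ ⁅a, ⁅b, c⁆⁆ := by
  classical
  choose n π h using exists_isAbelianSplitting (L := L)
  -- Every identity below involves finitely many elements, so it holds for all sufficiently large
  -- `S`.
  have ev : ∀ a : L, ∀ᶠ S : Finset L in atTop, a ∈ AddSubgroup.closure (S : Set L) := fun a =>
    (eventually_ge_atTop {a}).mono fun S hS => AddSubgroup.subset_closure (hS (by simp))
  refine ⟨(atTop : Filter (Finset L)).Germ L, inferInstance,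
    { toFun := fun a => (a : (atTop : Filter (Finset L)).Germ L)
      map_zero' := rfl
      map_add' := fun _ _ => rfl },
    AddMonoidHom.mk' (fun a => AddMonoidHom.mk'
      (fun b => ((fun S => splitLie (π S) a b : Finset L → L) : (atTop : Filter (Finset L)).Germ L))
      fun b b' => Germ.coe_eq.2 ?_) fun a a' => ?_,
    AddMonoidHom.mk' (fun a => AddMonoidHom.mk' (fun b => AddMonoidHom.mk'
      (fun c => ((fun S => splitLieLie (π S) a b c : Finset L → L) : (atTop : Filter (Finset L)).Germ L))
      fun c c' => Germ.coe_eq.2 ?_) fun b b' => ?_) fun a a' => ?_, ?_, ?_, ?_, ?_⟩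
  · filter_upwards [ev b, ev b'] with S h1 h2 using (h S).splitLie_add_right a h1 h2
  · ext b
    refine Germ.coe_eq.2 ?_
    filter_upwards [ev a, ev a'] with S h1 h2 using (h S).splitLie_add_left h1 h2 b
  · filter_upwards [ev c, ev c'] with S h1 h2 using (h S).splitLieLie_add_right a b h1 h2
  · ext c
    refine Germ.coe_eq.2 ?_
    filter_upwards [ev b, ev b'] with S h1 h2 using (h S).splitLieLie_add_mid a h1 h2 c
  · ext b c
    refine Germ.coe_eq.2 ?_
    filter_upwards [ev a, ev a'] with S h1 h2 using (h S).splitLieLie_add_left h1 h2 b c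
  · exact fun a b hab => Germ.const_inj.1 hab
  · intro a b
    refine Germ.coe_eq.2 ?_
    filter_upwards [ev a, ev b] with S h1 h2 using (h S).splitLie_sub h1 h2
  · intro a b c
    exact Germ.coe_eq.2 (Eventually.of_forall fun S => (h S).splitLieLie_comm a b c)
  · intro a b c
    refine Germ.coe_eq.2 ?_
    filter_upwards [ev a, ev b, ev c] with S h1 h2 h3 using (h S).splitLieLie_sub h1 h2 h3

end Splitting

/-! ### Modules over the universal enveloping ring on which the augmentation ideal is nilpotent -/

section Augmentation

attribute [local instance] LieRing.ofAssociativeRing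

variable {L : Type*} [LieRing L]

theorem ι_mem_lieAugmentation (x : L) :
    UniversalEnvelopingAlgebra.ι ℤ x ∈ lieAugmentation L :=
  TwoSidedIdeal.mem_asIdeal.2 (TwoSidedIdeal.subset_span ⟨x, rfl⟩)

/-- In `U(L)` a bracket becomes `yx - xy`, and each product gains one power of the augmentation
ideal. -/
theorem lieGamma_le_lieDelta (n : ℕ) : lieGamma L (n + 1) ≤ lieDelta L (n + 1) := by
  unfold lieGamma
  rw [Nat.add_sub_cancel]
  induction n with
  | zero =>
    intro x _
    rw [mem_lieDelta, zero_add, Submodule.pow_one]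
    exact ι_mem_lieAugmentation x
  | succ n ih =>
    rw [LieModule.lowerCentralSeries_succ, LieSubmodule.lieIdeal_oper_eq_linear_span',
      Submodule.span_le]
    rintro _ ⟨y, -, x, hx, rfl⟩
    have hx' := (mem_lieDelta L _ x).1 (ih hx)
    have hy := ι_mem_lieAugmentation y
    rw [SetLike.mem_coe, mem_lieDelta, LieHom.map_lie, LieRing.of_associative_ring_bracket]
    refine sub_mem ?_ ?_
    · rw [Submodule.pow_succ' _ n.succ_ne_zero]
      exact Ideal.mul_mem_mul hy hx'
    · rw [Submodule.pow_succ]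
      exact Ideal.mul_mem_mul hx' hy

variable {M : Type*} [AddCommGroup M] {F : ℕ → AddSubgroup M} {ρ : L →ₗ⁅ℤ⁆ Module.End ℤ M}

/-- Endomorphisms preserving every `F j` form a subalgebra containing the image of `ρ`, so the lift
of `ρ` factors through it. -/
theorem lift_apply_mem_filtration (hF : Antitone F)
    (hρ : ∀ x j, ∀ m ∈ F j, ρ x m ∈ F (j + 1)) (u : UniversalEnvelopingAlgebra ℤ L) (j : ℕ) (m : M)
    (hm : m ∈ F j) : UniversalEnvelopingAlgebra.lift ℤ ρ u m ∈ F j := by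
  let S : Subalgebra ℤ (Module.End ℤ M) :=
    { carrier := {g | ∀ j, ∀ m ∈ F j, g m ∈ F j}
      mul_mem' := fun {a b} ha hb j m hm => ha j _ (hb j m hm)
      add_mem' := fun {a b} ha hb j m hm => add_mem (ha j m hm) (hb j m hm)
      algebraMap_mem' := fun r j m hm => by
        rw [Module.algebraMap_end_apply]; exact zsmul_mem hm r }
  let ρ' : L →ₗ⁅ℤ⁆ S :=
    { toFun := fun x => ⟨ρ x, fun j m hm => hF j.le_succ (hρ x j m hm)⟩
      map_add' := fun x y => Subtype.ext (map_add ρ x y)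
      map_smul' := fun r x => Subtype.ext (map_smul ρ r x)
      map_lie' := fun {x y} => Subtype.ext (LieHom.map_lie ρ x y) }
  have h : S.val.comp (UniversalEnvelopingAlgebra.lift ℤ ρ') =
      UniversalEnvelopingAlgebra.lift ℤ ρ := by
    apply UniversalEnvelopingAlgebra.hom_ext
    ext x : 1
    simp [ρ']
  rw [← h]
  exact (UniversalEnvelopingAlgebra.lift ℤ ρ' u).2 j m hm

/-- The elements of `U(L)` that raise the filtration by one form a two-sided ideal, since all of
`U(L)` preserves the filtration; this ideal contains the generators `ι x`. -/
theorem lift_apply_mem_of_mem_lieAugmentation (hF : Antitone F)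
    (hρ : ∀ x j, ∀ m ∈ F j, ρ x m ∈ F (j + 1)) {u : UniversalEnvelopingAlgebra ℤ L}
    (hu : u ∈ lieAugmentation L) (j : ℕ) (m : M) (hm : m ∈ F j) :
    UniversalEnvelopingAlgebra.lift ℤ ρ u m ∈ F (j + 1) := by
  have key := lift_apply_mem_filtration hF hρ
  let J : TwoSidedIdeal (UniversalEnvelopingAlgebra ℤ L) := TwoSidedIdeal.mk'
    {u | ∀ j, ∀ m ∈ F j, UniversalEnvelopingAlgebra.lift ℤ ρ u m ∈ F (j + 1)}
    (fun j m _ => by simp)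
    (fun {a b} ha hb j m hm => by
      rw [map_add, LinearMap.add_apply]; exact add_mem (ha j m hm) (hb j m hm))
    (fun {a} ha j m hm => by rw [map_neg, LinearMap.neg_apply]; exact neg_mem (ha j m hm))
    (fun {a b} hb j m hm => by
      rw [map_mul, Module.End.mul_apply]; exact key a _ _ (hb j m hm))
    (fun {a b} ha j m hm => by
      rw [map_mul, Module.End.mul_apply]; exact ha j _ (key b j m hm))
  have hJ : TwoSidedIdeal.span (Set.range (UniversalEnvelopingAlgebra.ι ℤ (L := L))) ≤ J := by
    rw [TwoSidedIdeal.span_le]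
    rintro _ ⟨x, rfl⟩
    refine (TwoSidedIdeal.mem_mk' _ _ _ _ _ _ _).2 fun j m hm => ?_
    rw [UniversalEnvelopingAlgebra.lift_ι_apply]
    exact hρ x j m hm
  exact (TwoSidedIdeal.mem_mk' _ _ _ _ _ _ _).1 (hJ (TwoSidedIdeal.mem_asIdeal.1 hu)) j m hm

theorem lift_apply_mem_of_mem_lieAugmentation_pow (hF : Antitone F)
    (hρ : ∀ x j, ∀ m ∈ F j, ρ x m ∈ F (j + 1)) (n : ℕ) {u : UniversalEnvelopingAlgebra ℤ L}
    (hu : u ∈ lieAugmentation L ^ n) (j : ℕ) (m : M) (hm : m ∈ F j) :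
    UniversalEnvelopingAlgebra.lift ℤ ρ u m ∈ F (j + n) := by
  induction n generalizing u j m with
  | zero => exact lift_apply_mem_filtration hF hρ u j m hm
  | succ n ih =>
    rw [Submodule.pow_succ] at hu
    refine Submodule.mul_induction_on hu (fun a ha b hb => ?_) fun a b ha hb => ?_
    · rw [map_mul, Module.End.mul_apply, add_comm n, ← add_assoc]
      exact ih ha _ _ (lift_apply_mem_of_mem_lieAugmentation hF hρ hb j m hm)
    · rw [map_add, LinearMap.add_apply]
      exact add_mem ha hb

theorem apply_mem_of_mem_lieDelta (hF : Antitone F) (hρ : ∀ x j, ∀ m ∈ F j, ρ x m ∈ F (j + 1))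
    {n : ℕ} {x : L} (hx : x ∈ lieDelta L n) (j : ℕ) (m : M) (hm : m ∈ F j) :
    ρ x m ∈ F (j + n) := by
  rw [← UniversalEnvelopingAlgebra.lift_ι_apply ℤ ρ]
  exact lift_apply_mem_of_mem_lieAugmentation_pow hF hρ n ((mem_lieDelta L n x).1 hx) j m hm

end Augmentation

/-! ### Lie rings with projections onto the first three degrees -/

/-- Additive endomorphisms that behave under the bracket like the projections of a graded Lie ring
without component of degree `0` onto its components of degree `1`, `2` and `3`. -/
structure IsLieTruncation {L : Type*} [LieRing L] (p₁ p₂ p₃ : L →+ L) : Prop where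
  one : ∀ x y : L, p₁ ⁅x, y⁆ = 0
  two : ∀ x y : L, p₂ ⁅x, y⁆ = ⁅p₁ x, p₁ y⁆
  three : ∀ x y : L, p₃ ⁅x, y⁆ = ⁅p₁ x, p₂ y⁆ + ⁅p₂ x, p₁ y⁆

namespace IsLieTruncation

/-! ### A filtered representation detecting degrees one to three -/

section Action

attribute [local instance] LieRing.ofAssociativeRing

variable {L Q : Type*} [LieRing L] [AddCommGroup Q]

/-- The map `z ↦ (a ↦ χ ⁅a, z⁆)`. -/
def lieRight (χ : L →+ Q) : L →+ L →+ Q :=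
  AddMonoidHom.mk' (fun z => AddMonoidHom.mk' (fun a => χ ⁅a, z⁆) fun a b => by simp)
    fun z z' => by ext a; simp

theorem lieRight_apply (χ : L →+ Q) (z a : L) : lieRight χ z a = χ ⁅a, z⁆ := rfl

variable (p₁ p₂ p₃ : L →+ L) (χ : L →+ Q) (s : L →+ L →+ Q) (t : L →+ L →+ L →+ Q)

/-- The action of an element of a Lie ring on `ℤ × L × Q × (L →+ Q) × Q` determined by the
components of that element and by additive maps `χ`, `s`, `t` into `Q`. -/
def actionFun (y : L) (m : ℤ × L × Q × (L →+ Q) × Q) : ℤ × L × Q × (L →+ Q) × Q :=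
  (0, m.1 • p₁ y, s (p₁ y) m.2.1 + m.1 • χ (p₂ y),
    (t (p₁ y)).flip m.2.1 + m.1 • lieRight χ (p₂ y), m.2.2.2.1 (p₁ y) + m.1 • χ (p₃ y))

theorem actionFun_add_right (y : L) (m m' : ℤ × L × Q × (L →+ Q) × Q) :
    actionFun p₁ p₂ p₃ χ s t y (m + m') =
      actionFun p₁ p₂ p₃ χ s t y m + actionFun p₁ p₂ p₃ χ s t y m' := by
  refine Prod.ext (add_zero _).symm (Prod.ext ?_ (Prod.ext ?_ (Prod.ext ?_ ?_)))
  · exact add_smul _ _ _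
  · change s (p₁ y) (m.2.1 + m'.2.1) + (m.1 + m'.1) • χ (p₂ y) = (_ + _) + (_ + _)
    rw [map_add, add_smul, add_add_add_comm]
  · change (t (p₁ y)).flip (m.2.1 + m'.2.1) + (m.1 + m'.1) • lieRight χ (p₂ y) = (_ + _) + (_ + _)
    rw [map_add, add_smul, add_add_add_comm]
  · change (m.2.2.2.1 + m'.2.2.2.1) (p₁ y) + (m.1 + m'.1) • χ (p₃ y) = (_ + _) + (_ + _)
    rw [AddMonoidHom.add_apply, add_smul, add_add_add_comm]

theorem actionFun_add_left (y y' : L) (m : ℤ × L × Q × (L →+ Q) × Q) :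
    actionFun p₁ p₂ p₃ χ s t (y + y') m =
      actionFun p₁ p₂ p₃ χ s t y m + actionFun p₁ p₂ p₃ χ s t y' m := by
  refine Prod.ext (add_zero _).symm (Prod.ext ?_ (Prod.ext ?_ (Prod.ext ?_ ?_)))
  · change m.1 • p₁ (y + y') = m.1 • p₁ y + m.1 • p₁ y'
    rw [map_add, smul_add]
  · change s (p₁ (y + y')) m.2.1 + m.1 • χ (p₂ (y + y')) = (_ + _) + (_ + _)
    simp only [map_add, smul_add, AddMonoidHom.add_apply]
    exact add_add_add_comm _ _ _ _
  · change (t (p₁ (y + y'))).flip m.2.1 + m.1 • lieRight χ (p₂ (y + y')) = (_ + _) + (_ + _)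
    have h : (t (p₁ (y + y'))).flip m.2.1 = (t (p₁ y)).flip m.2.1 + (t (p₁ y')).flip m.2.1 := by
      ext a
      simp
    rw [h, map_add p₂, map_add (lieRight χ), smul_add]
    exact add_add_add_comm _ _ _ _
  · change m.2.2.2.1 (p₁ (y + y')) + m.1 • χ (p₃ (y + y')) = (_ + _) + (_ + _)
    simp only [map_add, smul_add]
    exact add_add_add_comm _ _ _ _

variable {p₁ p₂ p₃ χ s t}

/-- The third coordinate uses the antisymmetrization of `s` to produce `p₂ ⁅y, z⁆`. The fourth uses
that of `t` to record `a ↦ χ ⁅a, p₂ ⁅y, z⁆⁆`; evaluated at a degree-one component, such functionals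
give the brackets that make up `p₃`. -/
theorem actionFun_lie (h : IsLieTruncation p₁ p₂ p₃) (hs : ∀ a b, s a b - s b a = χ ⁅a, b⁆)
    (ht : ∀ a b c, t a b c = t b a c) (ht' : ∀ a b c, t a b c - t a c b = χ ⁅a, ⁅b, c⁆⁆)
    (y z : L) (m : ℤ × L × Q × (L →+ Q) × Q) :
    actionFun p₁ p₂ p₃ χ s t ⁅y, z⁆ m =
      actionFun p₁ p₂ p₃ χ s t y (actionFun p₁ p₂ p₃ χ s t z m) -
        actionFun p₁ p₂ p₃ χ s t z (actionFun p₁ p₂ p₃ χ s t y m) := by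
  refine Prod.ext (sub_zero _).symm (Prod.ext ?_ (Prod.ext ?_ (Prod.ext ?_ ?_)))
  · change m.1 • p₁ ⁅y, z⁆ = (0 : ℤ) • p₁ y - (0 : ℤ) • p₁ z
    rw [h.one, zero_smul, zero_smul, sub_zero, smul_zero]
  · change s (p₁ ⁅y, z⁆) m.2.1 + m.1 • χ (p₂ ⁅y, z⁆) =
      (s (p₁ y) (m.1 • p₁ z) + (0 : ℤ) • χ (p₂ y)) - (s (p₁ z) (m.1 • p₁ y) + (0 : ℤ) • χ (p₂ z))
    rw [h.one, h.two, ← hs, map_zero, AddMonoidHom.zero_apply, map_zsmul, map_zsmul, zero_smul,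
      zero_smul, smul_sub]
    abel
  · change (t (p₁ ⁅y, z⁆)).flip m.2.1 + m.1 • lieRight χ (p₂ ⁅y, z⁆) =
      ((t (p₁ y)).flip (m.1 • p₁ z) + (0 : ℤ) • lieRight χ (p₂ y)) -
        ((t (p₁ z)).flip (m.1 • p₁ y) + (0 : ℤ) • lieRight χ (p₂ z))
    rw [h.one, h.two, map_zero t, map_zsmul, map_zsmul, zero_smul, zero_smul]
    ext a
    simp only [AddMonoidHom.add_apply, AddMonoidHom.sub_apply, AddMonoidHom.flip_apply,
      AddMonoidHom.zero_apply, AddMonoidHom.smul_apply, lieRight_apply, ← ht', smul_sub,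
      ht _ a]
    abel
  -- Symmetry of `t` in its first two arguments cancels the terms in `m.2.1`; what remains is the
  -- formula for `p₃ ⁅y, z⁆`.
  · change m.2.2.2.1 (p₁ ⁅y, z⁆) + m.1 • χ (p₃ ⁅y, z⁆) =
      (((t (p₁ z)).flip m.2.1 + m.1 • lieRight χ (p₂ z)) (p₁ y) + (0 : ℤ) • χ (p₃ y)) -
        (((t (p₁ y)).flip m.2.1 + m.1 • lieRight χ (p₂ y)) (p₁ z) + (0 : ℤ) • χ (p₃ z))
    rw [h.one, h.three, map_zero, zero_smul, zero_smul, ← lie_skew (p₂ y)]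
    simp only [AddMonoidHom.add_apply, AddMonoidHom.flip_apply, AddMonoidHom.smul_apply,
      lieRight_apply, map_add, map_neg, smul_add, smul_neg, ht (p₁ z) (p₁ y)]
    abel

/-- The representation of a Lie ring given by `actionFun`. -/
def action (h : IsLieTruncation p₁ p₂ p₃) (hs : ∀ a b, s a b - s b a = χ ⁅a, b⁆)
    (ht : ∀ a b c, t a b c = t b a c) (ht' : ∀ a b c, t a b c - t a c b = χ ⁅a, ⁅b, c⁆⁆) :
    L →ₗ⁅ℤ⁆ Module.End ℤ (ℤ × L × Q × (L →+ Q) × Q) :=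
  { (AddMonoidHom.mk' (fun y => (AddMonoidHom.mk' (actionFun p₁ p₂ p₃ χ s t y)
      (actionFun_add_right p₁ p₂ p₃ χ s t y)).toIntLinearMap)
      (fun y y' => LinearMap.ext (actionFun_add_left p₁ p₂ p₃ χ s t y y'))).toIntLinearMap with
    map_lie' := fun {y z} => LinearMap.ext (actionFun_lie h hs ht ht' y z) }

theorem action_apply (h : IsLieTruncation p₁ p₂ p₃) (hs : ∀ a b, s a b - s b a = χ ⁅a, b⁆)
    (ht : ∀ a b c, t a b c = t b a c) (ht' : ∀ a b c, t a b c - t a c b = χ ⁅a, ⁅b, c⁆⁆)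
    (y : L) (m) : action h hs ht ht' y m = actionFun p₁ p₂ p₃ χ s t y m := rfl

/-- The filtration of `ℤ × L × Q × (L →+ Q) × Q` by degree, the factors being of degrees `0`, `1`,
`2`, `2` and `3`. -/
def filtration (L Q : Type*) [AddCommGroup L] [AddCommGroup Q] (j : ℕ) :
    AddSubgroup (ℤ × L × Q × (L →+ Q) × Q) where
  carrier := {m | (0 < j → m.1 = 0) ∧ (1 < j → m.2.1 = 0) ∧
    (2 < j → m.2.2.1 = 0 ∧ m.2.2.2.1 = 0) ∧ (3 < j → m.2.2.2.2 = 0)}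
  zero_mem' := ⟨fun _ => rfl, fun _ => rfl, fun _ => ⟨rfl, rfl⟩, fun _ => rfl⟩
  add_mem' := by
    rintro a b ⟨h1, h2, h3, h4⟩ ⟨k1, k2, k3, k4⟩
    refine ⟨fun h => ?_, fun h => ?_, fun h => ⟨?_, ?_⟩, fun h => ?_⟩
    · exact (congrArg₂ _ (h1 h) (k1 h)).trans (add_zero _)
    · exact (congrArg₂ _ (h2 h) (k2 h)).trans (add_zero _)
    · exact (congrArg₂ _ (h3 h).1 (k3 h).1).trans (add_zero _)
    · exact (congrArg₂ _ (h3 h).2 (k3 h).2).trans (add_zero _)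
    · exact (congrArg₂ _ (h4 h) (k4 h)).trans (add_zero _)
  neg_mem' := by
    rintro a ⟨h1, h2, h3, h4⟩
    refine ⟨fun h => ?_, fun h => ?_, fun h => ⟨?_, ?_⟩, fun h => ?_⟩
    · exact (congrArg _ (h1 h)).trans neg_zero
    · exact (congrArg _ (h2 h)).trans neg_zero
    · exact (congrArg _ (h3 h).1).trans neg_zero
    · exact (congrArg _ (h3 h).2).trans neg_zero
    · exact (congrArg _ (h4 h)).trans neg_zero

theorem filtration_antitone : Antitone (filtration L Q) := fun _ _ hij _ ⟨h1, h2, h3, h4⟩ =>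
  ⟨fun h => h1 (h.trans_le hij), fun h => h2 (h.trans_le hij), fun h => h3 (h.trans_le hij),
    fun h => h4 (h.trans_le hij)⟩

theorem actionFun_mem_filtration (y : L) (j : ℕ) (m) (hm : m ∈ filtration L Q j) :
    actionFun p₁ p₂ p₃ χ s t y m ∈ filtration L Q (j + 1) := by
  obtain ⟨h1, h2, h3, -⟩ := hm
  refine ⟨fun h => rfl, fun h => ?_, fun h => ⟨?_, ?_⟩, fun h => ?_⟩
  · simp [actionFun, h1 (by omega)]
  · simp [actionFun, h1 (by omega), h2 (by omega)]
  · simp [actionFun, h1 (by omega), h2 (by omega)]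
  · simp [actionFun, h1 (by omega), (h3 (by omega)).2]

end Action

variable {L : Type*} [LieRing L] {p₁ p₂ p₃ : L →+ L}

theorem eq_zero_of_mem_lieDelta (h : IsLieTruncation p₁ p₂ p₃) {x : L} (hx : x ∈ lieDelta L 4) :
    p₁ x = 0 ∧ p₂ x = 0 ∧ p₃ x = 0 := by
  obtain ⟨Q, _, χ, s, t, hχ, hs, ht, ht'⟩ := exists_splitting_maps L
  -- The vector `(1, 0, 0, 0, 0)` lies in `F 0`, so its image under `x` lies in `F 4 = 0`; the
  -- coordinates of that image include `p₁ x`, `χ (p₂ x)` and `χ (p₃ x)`.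
  have key := apply_mem_of_mem_lieDelta (ρ := action h hs ht ht') filtration_antitone
    (fun y j m hm => actionFun_mem_filtration y j m hm) hx 0 (1, 0, 0, 0, 0)
    ⟨fun h => absurd h (by simp), fun h => absurd h (by simp), fun h => absurd h (by simp),
      fun h => absurd h (by simp)⟩
  rw [action_apply] at key
  obtain ⟨-, h2, h3, h4⟩ := key
  have e1 := h2 (by simp)
  have e2 := (h3 (by simp)).1
  have e3 := h4 (by simp)
  simp only [actionFun, one_smul, map_zero, zero_add, AddMonoidHom.zero_apply] at e1 e2 e3
  exact ⟨e1, hχ (e2.trans (map_zero χ).symm), hχ (e3.trans (map_zero χ).symm)⟩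

/-! ### The remainder beyond degree three -/

theorem lie_mem_lowerCentralSeries_of_left {k : ℕ} {a : L}
    (ha : a ∈ LieModule.lowerCentralSeries ℤ L L k) (b : L) :
    ⁅a, b⁆ ∈ LieModule.lowerCentralSeries ℤ L L (k + 1) := by
  rw [← lie_skew, LieModule.lowerCentralSeries_succ]
  exact neg_mem (LieSubmodule.lie_mem_lie (LieSubmodule.mem_top b) ha)

theorem lie_mem_lowerCentralSeries_of_right {k : ℕ} (a : L) {b : L}
    (hb : b ∈ LieModule.lowerCentralSeries ℤ L L k) :
    ⁅a, b⁆ ∈ LieModule.lowerCentralSeries ℤ L L (k + 1) := by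
  rw [LieModule.lowerCentralSeries_succ]
  exact LieSubmodule.lie_mem_lie (LieSubmodule.mem_top a) hb

/-- With indices counted from zero, this is `[γ_2, γ_2] ⊆ γ_4`: the Jacobi identity rewrites `⁅⁅x,
y⁆, b⁆` through `⁅x, ⁅y, b⁆⁆` and `⁅y, ⁅x, b⁆⁆`. -/
theorem lie_mem_lowerCentralSeries_three {a b : L}
    (ha : a ∈ LieModule.lowerCentralSeries ℤ L L 1)
    (hb : b ∈ LieModule.lowerCentralSeries ℤ L L 1) :
    ⁅a, b⁆ ∈ LieModule.lowerCentralSeries ℤ L L 3 := by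
  rw [LieModule.lowerCentralSeries_succ, ← LieSubmodule.mem_toSubmodule,
    LieSubmodule.lieIdeal_oper_eq_linear_span'] at ha
  induction ha using Submodule.span_induction with
  | mem c hc =>
    obtain ⟨x, -, y, -, rfl⟩ := hc
    rw [lie_lie]
    exact sub_mem
      (lie_mem_lowerCentralSeries_of_right _ (lie_mem_lowerCentralSeries_of_right _ hb))
      (lie_mem_lowerCentralSeries_of_right _ (lie_mem_lowerCentralSeries_of_right _ hb))
  | zero => rw [zero_lie]; exact zero_mem _
  | add c d _ _ hc hd => rw [add_lie]; exact add_mem hc hd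
  | smul r c _ hc => rw [smul_lie]; exact SMulMemClass.smul_mem r hc

/-- Only the last assertion is the goal; the first two strengthen the induction over the Lie span so
that the bracket step closes. -/
theorem sub_mem_lowerCentralSeries (h : IsLieTruncation p₁ p₂ p₃)
    (hspan : LieSubalgebra.lieSpan ℤ L {x | p₁ x = x ∧ p₂ x = 0 ∧ p₃ x = 0} = ⊤) (x : L) :
    p₂ x ∈ LieModule.lowerCentralSeries ℤ L L 1 ∧ p₃ x ∈ LieModule.lowerCentralSeries ℤ L L 2 ∧
      x - (p₁ x + p₂ x + p₃ x) ∈ LieModule.lowerCentralSeries ℤ L L 3 := by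
  have hx : x ∈ LieSubalgebra.lieSpan ℤ L {x | p₁ x = x ∧ p₂ x = 0 ∧ p₃ x = 0} := hspan ▸ trivial
  induction hx using LieSubalgebra.lieSpan_induction with
  | mem x hx =>
    obtain ⟨h1, h2, h3⟩ := hx
    simp [h1, h2, h3]
  | zero => simp
  | add x y _ _ hx hy =>
    simp only [map_add]
    refine ⟨add_mem hx.1 hy.1, add_mem hx.2.1 hy.2.1, ?_⟩
    convert add_mem hx.2.2 hy.2.2 using 1
    abel
  | smul r x _ hx =>
    simp only [map_zsmul, ← smul_add, ← smul_sub]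
    exact ⟨SMulMemClass.smul_mem r hx.1, SMulMemClass.smul_mem r hx.2.1,
      SMulMemClass.smul_mem r hx.2.2⟩
  | lie x y _ _ hx hy =>
    obtain ⟨hx2, hx3, hx4⟩ := hx
    obtain ⟨hy2, hy3, hy4⟩ := hy
    have anti := LieModule.antitone_lowerCentralSeries ℤ L L
    rw [h.one, h.two, h.three]
    have hy1 : y - p₁ y ∈ LieModule.lowerCentralSeries ℤ L L 1 := by
      convert add_mem (add_mem hy2 (anti (by omega) hy3)) (anti (by omega : 1 ≤ 3) hy4) using 1
      abel
    have hy12 : y - (p₁ y + p₂ y) ∈ LieModule.lowerCentralSeries ℤ L L 2 := by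
      convert add_mem hy3 (anti (by omega : 2 ≤ 3) hy4) using 1
      abel
    have hx12 : x - (p₁ x + p₂ x) ∈ LieModule.lowerCentralSeries ℤ L L 2 := by
      convert add_mem hx3 (anti (by omega : 2 ≤ 3) hx4) using 1
      abel
    refine ⟨lie_mem_lowerCentralSeries_of_left (by simp) _, add_mem
      (lie_mem_lowerCentralSeries_of_right _ hy2) (lie_mem_lowerCentralSeries_of_left hx2 _), ?_⟩
    -- The remainder of `⁅x, y⁆` equals `⁅p₁ x, y - p₁ y - p₂ y⁆ + ⁅p₂ x, y - p₁ y⁆ + ⁅x - p₁ x - p₂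
    -- x, y⁆`.
    convert add_mem (add_mem (lie_mem_lowerCentralSeries_of_right (p₁ x) hy12)
      (lie_mem_lowerCentralSeries_three hx2 hy1))
      (lie_mem_lowerCentralSeries_of_left hx12 y) using 1
    simp only [lie_sub, sub_lie, lie_add, add_lie]
    abel

theorem lieDelta_four_eq (h : IsLieTruncation p₁ p₂ p₃)
    (hspan : LieSubalgebra.lieSpan ℤ L {x | p₁ x = x ∧ p₂ x = 0 ∧ p₃ x = 0} = ⊤) :
    lieDelta L 4 = lieGamma L 4 := by
  refine le_antisymm (fun x hx => ?_) (lieGamma_le_lieDelta 3)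
  obtain ⟨h1, h2, h3⟩ := h.eq_zero_of_mem_lieDelta hx
  have := (h.sub_mem_lowerCentralSeries hspan x).2.2
  rwa [h1, h2, h3, add_zero, add_zero, sub_zero] at this

end IsLieTruncation

/-! ### Graded Lie rings and the Magnus Lie ring -/

/-- With respect to the projections `p`, the element `x` is homogeneous of degree `n`. -/
def IsHomogeneousFor {L : Type*} [LieRing L] (p : ℕ → L →+ L) (n : ℕ) (x : L) : Prop :=
  ∀ k, p k x = if k = n then x else 0

/-! ### Homogeneous projections and the bracket -/

section Projections

variable {L : Type*} [LieRing L] {p : ℕ → L →+ L}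

theorem proj_lie_eq_sum (hp : AddSubgroup.closure {x | ∃ n, IsHomogeneousFor p n x} = ⊤)
    (hlie : ∀ m n x y, IsHomogeneousFor p m x → IsHomogeneousFor p n y →
      IsHomogeneousFor p (m + n) ⁅x, y⁆) (k : ℕ) (x y : L) :
    p k ⁅x, y⁆ = ∑ ij ∈ Finset.HasAntidiagonal.antidiagonal k, ⁅p ij.1 x, p ij.2 y⁆ := by
  have hx : x ∈ AddSubgroup.closure {x | ∃ n, IsHomogeneousFor p n x} := hp ▸ trivial
  have hy : y ∈ AddSubgroup.closure {x | ∃ n, IsHomogeneousFor p n x} := hp ▸ trivial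
  induction hx using AddSubgroup.closure_induction with
  | zero => simp
  | add a b _ _ ha hb => simp [ha, hb, Finset.sum_add_distrib]
  | neg a _ ha => simp only [neg_lie, map_neg, ha, Finset.sum_neg_distrib]
  | mem a ha =>
  induction hy using AddSubgroup.closure_induction with
  | zero => simp
  | add b c _ _ hb hc => simp [hb, hc, Finset.sum_add_distrib]
  | neg b _ hb => simp only [lie_neg, map_neg, hb, Finset.sum_neg_distrib]
  | mem b hb =>
  obtain ⟨m, ha⟩ := ha
  obtain ⟨n, hb⟩ := hb
  rw [hlie m n a b ha hb k]
  have e : ∀ ij ∈ Finset.HasAntidiagonal.antidiagonal k,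
      ⁅p ij.1 a, p ij.2 b⁆ = if ij = (m, n) then ⁅a, b⁆ else 0 := by
    rintro ⟨i, j⟩ -
    rw [ha i, hb j]
    by_cases hi : i = m <;> by_cases hj : j = n <;> simp [hi, hj]
  rw [Finset.sum_congr rfl e, Finset.sum_ite_eq']
  simp [eq_comm]

theorem isLieTruncation_of_proj (hp : AddSubgroup.closure {x | ∃ n, IsHomogeneousFor p n x} = ⊤)
    (hlie : ∀ m n x y, IsHomogeneousFor p m x → IsHomogeneousFor p n y →
      IsHomogeneousFor p (m + n) ⁅x, y⁆) (h0 : p 0 = 0) :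
    IsLieTruncation (p 1) (p 2) (p 3) where
  one x y := by simp [proj_lie_eq_sum hp hlie, Finset.Nat.antidiagonal_succ, h0]
  two x y := by simp [proj_lie_eq_sum hp hlie, Finset.Nat.antidiagonal_succ, h0]
  three x y := by simp [proj_lie_eq_sum hp hlie, Finset.Nat.antidiagonal_succ, h0]

/-- The degree-zero part of `⁅x, y⁆` is `⁅p 0 x, p 0 y⁆`, so vanishing on the degree-one generators
propagates. -/
theorem proj_zero_eq_zero (hp : AddSubgroup.closure {x | ∃ n, IsHomogeneousFor p n x} = ⊤)
    (hlie : ∀ m n x y, IsHomogeneousFor p m x → IsHomogeneousFor p n y →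
      IsHomogeneousFor p (m + n) ⁅x, y⁆)
    (hspan : LieSubalgebra.lieSpan ℤ L {x | IsHomogeneousFor p 1 x} = ⊤) : p 0 = 0 := by
  ext x
  have hx : x ∈ LieSubalgebra.lieSpan ℤ L {x | IsHomogeneousFor p 1 x} := hspan ▸ trivial
  induction hx using LieSubalgebra.lieSpan_induction with
  | mem x hx => simpa using hx 0
  | zero => simp
  | add x y _ _ hx hy => simp_all
  | smul r x _ hx => simp_all
  | lie x y _ _ hx hy => simp_all [proj_lie_eq_sum hp hlie]

/-- Phrasing the grading through projections covers both an internal grading over `ℕ` and the direct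
sum over `ℕ+` defining `gr G`. -/
theorem lieDelta_four_eq_of_proj
    (hp : AddSubgroup.closure {x | ∃ n, IsHomogeneousFor p n x} = ⊤)
    (hlie : ∀ m n x y, IsHomogeneousFor p m x → IsHomogeneousFor p n y →
      IsHomogeneousFor p (m + n) ⁅x, y⁆)
    (hspan : LieSubalgebra.lieSpan ℤ L {x | IsHomogeneousFor p 1 x} = ⊤) :
    lieDelta L 4 = lieGamma L 4 := by
  refine (isLieTruncation_of_proj hp hlie (proj_zero_eq_zero hp hlie hspan)).lieDelta_four_eq
    (top_le_iff.1 (hspan.ge.trans (LieSubalgebra.lieSpan_mono fun x hx => ?_)))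
  exact ⟨by simpa using hx 1, by simpa using hx 2, by simpa using hx 3⟩

end Projections

/-! ### Internally graded Lie rings -/

section Graded

variable {L : Type*} [LieRing L] (𝓛 : ℕ → Submodule ℤ L) [GradedLieAlgebra 𝓛]

/-- The projection of a graded Lie ring onto its component of degree `k`. -/
def gradedProj (k : ℕ) : L →+ L :=
  AddMonoidHom.mk' (fun x => (DirectSum.decompose 𝓛 x k : L)) fun x y => by
    rw [DirectSum.decompose_add, DirectSum.add_apply, Submodule.coe_add]

theorem isHomogeneousFor_gradedProj {n : ℕ} {x : L} :
    IsHomogeneousFor (gradedProj 𝓛) n x ↔ x ∈ 𝓛 n := by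
  refine ⟨fun h => ?_, fun h k => ?_⟩
  · have e : (DirectSum.decompose 𝓛 x n : L) = x := (h n).trans (if_pos rfl)
    exact e ▸ (DirectSum.decompose 𝓛 x n).2
  · change (DirectSum.decompose 𝓛 x k : L) = _
    split_ifs with hk
    · subst hk; exact DirectSum.decompose_of_mem_same 𝓛 h
    · exact DirectSum.decompose_of_mem_ne 𝓛 h (Ne.symm hk)

theorem lieDelta_four_eq_of_graded (h : LieSubalgebra.lieSpan ℤ L (𝓛 1 : Set L) = ⊤) :
    lieDelta L 4 = lieGamma L 4 := by
  refine lieDelta_four_eq_of_proj (p := gradedProj 𝓛) ?_ ?_ ?_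
  · simp only [isHomogeneousFor_gradedProj]
    refine (AddSubgroup.eq_top_iff' _).2 fun x => ?_
    induction x using DirectSum.Decomposition.inductionOn 𝓛 with
    | zero => exact zero_mem _
    | homogeneous m => exact AddSubgroup.subset_closure ⟨_, m.2⟩
    | add a b ha hb => exact add_mem ha hb
  · simp only [isHomogeneousFor_gradedProj]
    exact fun m n x y hx hy => SetLike.GradedBracket.bracket_mem hx hy
  · simp only [isHomogeneousFor_gradedProj]
    exact h

end Graded

/-! ### The grading of the Magnus Lie ring -/

namespace Magnus

variable {G : Type*} [Group G]

/-- The component of degree `n` of an element of `gr G`. -/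
def component (n : ℕ+) : MagnusLieRing G →+ Piece G n :=
  DFinsupp.evalAddMonoidHom (β := fun n : ℕ+ => Piece G n) n

/-- The projection of `gr G` onto its component of degree `k`, which is zero if `k = 0`. -/
def proj (k : ℕ) : MagnusLieRing G →+ MagnusLieRing G :=
  if h : 0 < k then (incl ⟨k, h⟩).comp (component ⟨k, h⟩) else 0

theorem isHomogeneousFor_cls (n : ℕ+) (x : G) (hx : x ∈ gamma G n) :
    IsHomogeneousFor proj n (cls n x hx) := by
  intro k
  unfold proj
  split_ifs with hk h h
  · obtain rfl : n = ⟨k, hk⟩ := PNat.eq h.symm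
    exact congrArg (incl _) (DirectSum.of_eq_same (β := fun n : ℕ+ => Piece G n) _ _)
  · have e : DirectSum.of (fun n : ℕ+ => Piece G n) n (Piece.mk x hx) ⟨k, hk⟩ = 0 :=
      DirectSum.of_eq_of_ne _ _ _ fun h' => h (by rw [← h']; rfl)
    exact (congrArg (incl ⟨k, hk⟩) e).trans (map_zero _)
  · exact absurd (h ▸ n.pos) hk
  · rfl

/-- The alternative `a = 0` accounts for degree `0`, where there is no component. -/
theorem exists_cls_of_isHomogeneousFor {n : ℕ} {a : MagnusLieRing G}
    (ha : IsHomogeneousFor proj n a) :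
    a = 0 ∨ ∃ (h : 0 < n) (x : G) (hx : x ∈ gamma G n), a = cls ⟨n, h⟩ x hx := by
  have e := ha n
  rw [if_pos rfl, proj] at e
  split_ifs at e with h
  · refine Or.inr ⟨h, ?_⟩
    rw [← e]
    change ∃ x hx, incl ⟨n, h⟩ (component ⟨n, h⟩ a) = incl ⟨n, h⟩ _
    generalize component (⟨n, h⟩ : ℕ+) a = b
    induction b using Piece.ind with
    | h x hx => exact ⟨x, hx, rfl⟩
  · exact Or.inl e.symm

/-- Each further term of the lower central series is generated by commutators of the previous term
with `G`, whose classes are brackets with degree-one classes; hence `gr G` is generated in degree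
one. -/
theorem cls_mem_lieSpan (n : ℕ) (x : G) (hx : x ∈ gamma G (n.succPNat : ℕ)) :
    cls n.succPNat x hx ∈
      LieSubalgebra.lieSpan ℤ (MagnusLieRing G) {a | IsHomogeneousFor proj 1 a} := by
  induction n generalizing x with
  | zero => exact LieSubalgebra.subset_lieSpan (isHomogeneousFor_cls _ x hx)
  | succ n ih =>
    have hx' : x ∈ Subgroup.closure
        {g | ∃ g₁ ∈ gamma G (n.succPNat : ℕ), ∃ g₂ ∈ (⊤ : Subgroup G), ⁅g₁, g₂⁆ = g} := hx
    have hle : ∀ y ∈ Subgroup.closure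
        {g | ∃ g₁ ∈ gamma G (n.succPNat : ℕ), ∃ g₂ ∈ (⊤ : Subgroup G), ⁅g₁, g₂⁆ = g},
        y ∈ gamma G ((n + 1).succPNat : ℕ) := fun y hy => hy
    induction hx' using Subgroup.closure_induction with
    | mem y hy =>
      obtain ⟨a, ha, b, -, rfl⟩ := hy
      have e := cls_bracket_alt n.succPNat 1 ha (mem_gamma_one b)
      rw [cls_eq (m := n.succPNat + 1) (n := (n + 1).succPNat) _ rfl] at e
      rw [← e]
      exact LieSubalgebra.lie_mem _ (ih a ha)
        (LieSubalgebra.subset_lieSpan (isHomogeneousFor_cls 1 b _))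
    | one => rw [cls_one]; exact zero_mem _
    | mul y z hy hz hy' hz' =>
      rw [cls_mul _ (hle y hy) (hle z hz)]
      exact add_mem (hy' _) (hz' _)
    | inv y hy hy' =>
      rw [cls_inv _ (hle y hy)]
      exact neg_mem (hy' _)

variable (G) in
theorem lieDelta_four_eq : lieDelta (MagnusLieRing G) 4 = lieGamma (MagnusLieRing G) 4 := by
  refine lieDelta_four_eq_of_proj (p := proj) ?_ ?_ ?_
  · refine (AddSubgroup.eq_top_iff' _).2 fun a => ?_
    induction a using cls_ind with
    | h0 => exact zero_mem _
    | hadd a b ha hb => exact add_mem ha hb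
    | h n x hx => exact AddSubgroup.subset_closure ⟨_, isHomogeneousFor_cls n x hx⟩
  · intro m n a b ha hb
    obtain rfl | ⟨hm, x, hx, rfl⟩ := exists_cls_of_isHomogeneousFor ha
    · intro k; simp
    obtain rfl | ⟨hn, y, hy, rfl⟩ := exists_cls_of_isHomogeneousFor hb
    · intro k; simp
    have e := cls_bracket_alt (⟨m, hm⟩ : ℕ+) ⟨n, hn⟩ hx hy
    have := isHomogeneousFor_cls _ _ (commutator_mem_pnat (m := ⟨m, hm⟩) (n := ⟨n, hn⟩) hx hy)
    rw [← e] at this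
    exact this
  · refine top_le_iff.1 fun a ha => ?_
    clear ha
    induction a using cls_ind with
    | h0 => exact zero_mem _
    | hadd a b ha hb => exact add_mem ha hb
    | h n x hx =>
      have := cls_mem_lieSpan n.natPred x (by rw [PNat.succPNat_natPred]; exact hx)
      rwa [cls_eq (n := n) _ (PNat.succPNat_natPred n)] at this

end Magnus

theorem mainTheorem8 :
    (∀ (L : Type*) [LieRing L] (𝓛 : ℕ → Submodule ℤ L) [GradedLieAlgebra 𝓛],
      LieSubalgebra.lieSpan ℤ L (𝓛 1 : Set L) = ⊤ → lieDelta L 4 = lieGamma L 4) ∧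
    (∀ (G : Type*) [Group G],
      lieDelta (MagnusLieRing G) 4 = lieGamma (MagnusLieRing G) 4) :=
  ⟨fun _ _ 𝓛 _ h => lieDelta_four_eq_of_graded 𝓛 h, fun G _ => Magnus.lieDelta_four_eq G⟩
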